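/- Let $d\ge 1$, $M\ge 0$ and $n\ge 0$ be integers. Let $X^*$ be a random vector in $\mathbb{R}^d$ with (prior) density $p_0$ whose differential entropy $H(p_0)=-\int p_0(x)\log p_0(x)\,dx$ exists and is finite (natural logarithm). In each cycle $k=0,1,2,\dots$ a controller asks $M$ players, $m=1,\dots,M$, whether $X^*$ lies in measurable query regions $A_k^{(m)}\subseteq\mathbb{R}^d$ (for instance finite unions of half-open rectangles), and receives responses $Y_{k+1}^{(m)}\in\{0,1\}$. Under a joint policy the $M$ regions of cycle $k$ are functions of the responses of the previous cycles; under a sequential policy the region for player $m$ may depend in addition on the responses of players $1,\dots,m-1$ in cycle $k$. In both cases the regions may also depend measurably on a random seed that is independent of $X^*$. Given $X^*$, the seed and the past, the responses are (conditionally independent) outputs of memoryless binary symmetric channels: $Y_{k+1}^{(m)}$ differs from the true answer $\mathbf{1}\{X^*\in A_k^{(m)}\}$ with probability $\epsilon_m\in(0,1/2)$; for a joint policy the $M$ responses of a cycle are conditionally independent given $X^*$, the seed and the responses of the previous cycles, and for a sequential policy the response of player $m$ is conditioned on $X^*$, the seed and all earlier responses. Let $p_n$ be the posterior density of $X^*$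 after $n$ cycles and let $X_n$ be a (coordinatewise) median of $p_n$. Then, for every joint and every sequential policy, $$\mathbb{E}\,\|X^*-X_n\|_2^2\;\ge\;\frac{K}{2\pi e}\,d\,\exp\!\left(-\frac{2nC}{d}\right),\qquad K=e^{2H(p_0)/d},\quad C=\sum_{m=1}^M C(\epsilon_m),$$ where $C(\epsilon)=\log 2+\epsilon\log\epsilon+(1-\epsilon)\log(1-\epsilon)$ is the capacity, in nats, of the binary symmetric channel with crossover probability $\epsilon$. The same bound holds with $X_n$ replaced by any estimator that is a measurable function of the seed and of the responses of the first $n$ cycles. (The mean-square error may be $+\infty$.) -/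

import Mathlib

open MeasureTheory ProbabilityTheory
open scoped ENNReal

noncomputable section

namespace TwentyQuestions

/-- The target space `ℝ^d` with the Euclidean norm. -/
abbrev Space (d : ℕ) : Type := EuclideanSpace ℝ (Fin d)

/-- Differential entropy (in nats) `H(p) = -∫ p(x) log p(x) dx`. -/
def diffEntropy {d : ℕ} (p : Space d → ℝ) : ℝ :=
  -∫ x, p x * Real.log (p x)

/-- The entropy integral converges absolutely, i.e. `H(p)` exists and is finite. -/
def HasFiniteEntropy {d : ℕ} (p : Space d → ℝ) : Prop :=
  Integrable (fun x => p x * Real.log (p x))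

/-- Capacity (in nats) of the binary symmetric channel with crossover probability `ε`. -/
def capacity (ε : ℝ) : ℝ :=
  Real.log 2 - Real.binEntropy ε

/-- Transition probability `P(response = y | true answer = z)` of the binary symmetric channel. -/
def bsc (ε : ℝ) (z y : Bool) : ℝ :=
  if y = z then 1 - ε else ε

open Classical in
/-- The truthful answer to the query "does `x` lie in `A`?". -/
def answer {d : ℕ} (A : Set (Space d)) (x : Space d) : Bool :=
  decide (x ∈ A)

/-- Responses of all `M` players in the first `k` cycles. -/
abbrev Record (M k : ℕ) : Type := Fin k → Fin M → Bool

/-- A joint policy: in cycle `k` the `M` queries are chosen together, as a function of the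
responses of the previous cycles (and of an optional random seed in `𝒰`; a deterministic policy is
one with `𝒰` a single point). Query regions are measurable, jointly with the seed. -/
structure JointPolicy (d M : ℕ) (𝒰 : Type*) [MeasurableSpace 𝒰] where
  query : (k : ℕ) → Record M k → 𝒰 → Fin M → Set (Space d)
  measurableSet_query : ∀ (k : ℕ) (h : Record M k) (m : Fin M),
    MeasurableSet {q : 𝒰 × Space d | q.2 ∈ query k h q.1 m}

/-- A sequential policy: in cycle `k` the query to player `t` may depend on the responses of the
previous cycles and also on the responses of players `0, …, t - 1` in the current cycle. -/
structure SequentialPolicy (d M : ℕ) (𝒰 : Type*) [MeasurableSpace 𝒰] where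
  query : (k : ℕ) → (t : Fin M) → Record M k → (Fin (t : ℕ) → Bool) → 𝒰 → Set (Space d)
  measurableSet_query : ∀ (k : ℕ) (t : Fin M) (h : Record M k) (h' : Fin (t : ℕ) → Bool),
    MeasurableSet {q : 𝒰 × Space d | q.2 ∈ query k t h h' q.1}

section Game

variable {Ω 𝒰 : Type*} [MeasurableSpace Ω] [MeasurableSpace 𝒰] {d M : ℕ}

/-- The responses of the first `k` cycles in the outcome `ω`. -/
def record (Y : ℕ → Ω → Fin M → Bool) (k : ℕ) (ω : Ω) : Record M k :=
  fun j m => Y j ω m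

/-- The responses of players `0, …, t - 1` in cycle `k` in the outcome `ω`. -/
def partialRecord (Y : ℕ → Ω → Fin M → Bool) (k : ℕ) (t : Fin M) (ω : Ω) : Fin (t : ℕ) → Bool :=
  fun s => Y k ω ⟨s, s.isLt.trans t.isLt⟩

/-- The queries that a joint policy poses in cycle `k` in the outcome `ω`. -/
def JointPolicy.asked (ζ : JointPolicy d M 𝒰) (U : Ω → 𝒰) (Y : ℕ → Ω → Fin M → Bool)
    (ω : Ω) (k : ℕ) (m : Fin M) : Set (Space d) :=
  ζ.query k (record Y k ω) (U ω) m

/-- The queries that a sequential policy poses in cycle `k` in the outcome `ω`. -/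
def SequentialPolicy.asked (ζ : SequentialPolicy d M 𝒰) (U : Ω → 𝒰) (Y : ℕ → Ω → Fin M → Bool)
    (ω : Ω) (k : ℕ) (t : Fin M) : Set (Space d) :=
  ζ.query k t (record Y k ω) (partialRecord Y k t ω) (U ω)

/-- The σ-algebra generated by the target, the seed and the responses of the first `k` cycles. -/
abbrev jointPast (X : Ω → Space d) (U : Ω → 𝒰) (Y : ℕ → Ω → Fin M → Bool) (k : ℕ) :
    MeasurableSpace Ω :=
  MeasurableSpace.comap (fun ω => (X ω, U ω, record Y k ω)) inferInstance

/-- The σ-algebra generated by the target, the seed, the responses of the first `k` cycles and the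
responses of players `0, …, t - 1` in cycle `k`. -/
abbrev sequentialPast (X : Ω → Space d) (U : Ω → 𝒰) (Y : ℕ → Ω → Fin M → Bool) (k : ℕ)
    (t : Fin M) : MeasurableSpace Ω :=
  MeasurableSpace.comap (fun ω => (X ω, U ω, record Y k ω, partialRecord Y k t ω)) inferInstance

/-- The probability that the players return the vector `y` to the queries `A` when the target is
at `x`: independent binary symmetric channels with crossover probabilities `ε m`. -/
def likelihood (ε : Fin M → ℝ) (A : Fin M → Set (Space d)) (y : Fin M → Bool) (x : Space d) : ℝ :=
  ∏ m, bsc (ε m) (answer (A m) x) (y m)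

/-- The target `X` has prior density `p₀` and is independent of the controller's seed `U`. -/
structure IsTargetModel (P : Measure Ω) (p₀ : Space d → ℝ) (X : Ω → Space d) (U : Ω → 𝒰)
    (Y : ℕ → Ω → Fin M → Bool) : Prop where
  measurable_target : Measurable X
  measurable_seed : Measurable U
  measurable_response : ∀ k, Measurable (Y k)
  measurable_prior : Measurable p₀
  prior_nonneg : ∀ x, 0 ≤ p₀ x
  map_target : P.map X = (volume : Measure (Space d)).withDensity (fun x => ENNReal.ofReal (p₀ x))
  indep_seed : IndepFun U X P

/-- Under a joint policy the responses of a cycle are, conditionally on the target and the past,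
independent outputs of memoryless binary symmetric channels fed with the true answers. -/
def IsJointGame (P : Measure Ω) (ε : Fin M → ℝ) (ζ : JointPolicy d M 𝒰) (X : Ω → Space d)
    (U : Ω → 𝒰) (Y : ℕ → Ω → Fin M → Bool) : Prop :=
  ∀ (k : ℕ) (y : Fin M → Bool),
    P⟦{ω | Y k ω = y} | jointPast X U Y k⟧ =ᵐ[P]
      fun ω => likelihood ε (ζ.asked U Y ω k) y (X ω)

/-- Under a sequential policy each single response is, conditionally on the target and the past,
the output of a memoryless binary symmetric channel fed with the true answer. -/
def IsSequentialGame (P : Measure Ω) (ε : Fin M → ℝ) (ζ : SequentialPolicy d M 𝒰)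
    (X : Ω → Space d) (U : Ω → 𝒰) (Y : ℕ → Ω → Fin M → Bool) : Prop :=
  ∀ (k : ℕ) (t : Fin M) (b : Bool),
    P⟦{ω | Y k ω t = b} | sequentialPast X U Y k t⟧ =ᵐ[P]
      fun ω => bsc (ε t) (answer (ζ.asked U Y ω k t) (X ω)) b

/-- Posterior density after `n` cycles by Bayes' rule, for queries `A` and responses `y`.
(Updating player by player within a cycle and normalizing each time gives the same density.) -/
def posterior (p₀ : Space d → ℝ) (ε : Fin M → ℝ) (A : ℕ → Fin M → Set (Space d))
    (y : ℕ → Fin M → Bool) : ℕ → Space d → ℝ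
  | 0 => p₀
  | n + 1 => fun x =>
      likelihood ε (A n) (y n) x * posterior p₀ ε A y n x /
        ∫ z, likelihood ε (A n) (y n) z * posterior p₀ ε A y n z

/-- `m` is a (coordinatewise) median of the probability density `p`; for `d = 1` this is the usual
notion. -/
def IsMedian (p : Space d → ℝ) (m : Space d) : Prop :=
  ∀ i, 1 / 2 ≤ ∫ x in {x | x i ≤ m i}, p x ∧ 1 / 2 ≤ ∫ x in {x | m i ≤ x i}, p x

/-- An estimator of the target after `n` cycles: a function of the responses of those cycles and of
the seed (which together determine the queries), measurable in the seed. -/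
structure Estimator (d M : ℕ) (𝒰 : Type*) [MeasurableSpace 𝒰] (n : ℕ) where
  toFun : Record M n → 𝒰 → Space d
  measurable_toFun : ∀ h, Measurable (toFun h)

/-- The estimate produced in the outcome `ω`. -/
def Estimator.estimate {n : ℕ} (e : Estimator d M 𝒰 n) (U : Ω → 𝒰) (Y : ℕ → Ω → Fin M → Bool)
    (ω : Ω) : Space d :=
  e.toFun (record Y n ω) (U ω)

/-- Mean-square error `E‖X - X̂‖²`, possibly infinite. -/
def mse (P : Measure Ω) (X X' : Ω → Space d) : ℝ≥0∞ :=
  ∫⁻ ω, ENNReal.ofReal (‖X ω - X' ω‖ ^ 2) ∂P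

/-- The lower bound `(K / (2πe)) d exp(-2nC/d)` with `K = exp(2 H(p₀) / d)` and
`C = ∑ m, C(ε m)`. -/
def mseBound (p₀ : Space d → ℝ) (ε : Fin M → ℝ) (n : ℕ) : ℝ :=
  Real.exp (2 * diffEntropy p₀ / d) / (2 * Real.pi * Real.exp 1) * d *
    Real.exp (-(2 * n * ∑ m, capacity (ε m)) / d)

end Game

end TwentyQuestions

end

/-!
Gibbs' inequality is applied to the true joint law of the target and the record of responses (given
the seed) against a reference law in which the responses are uniform and, given them, the target is
Gaussian around its estimate with variance `s` in each direction. Whatever the policy, the channel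
noise contributes the same entropy `binEntropy (ε m)` to every response, so by the chain rule the
expected log-likelihood of the record does not depend on the queries. What remains is a bound
`H(p₀) - n C ≤ d / 2 * log (2 π s) + mse / (2 s)`, which becomes the theorem for the best `s`.
-/

namespace TwentyQuestions

section Transition

variable {𝒱 α : Type*} [MeasurableSpace 𝒱] [Fintype α]

/-- `ℓ v` is a probability mass function on the finite alphabet `α`, depending measurably on `v`:
the real-valued form of a Markov kernel from `𝒱` to `α`, convenient for taking logarithms. -/
structure IsTransition (ℓ : 𝒱 → α → ℝ) : Prop where
  measurable : ∀ a, Measurable fun v => ℓ v a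
  nonneg : ∀ v a, 0 ≤ ℓ v a
  sum_eq_one : ∀ v, ∑ a, ℓ v a = 1

theorem IsTransition.comp {𝒲 : Type*} [MeasurableSpace 𝒲] {ℓ : 𝒱 → α → ℝ} (hℓ : IsTransition ℓ)
    {φ : 𝒲 → 𝒱} (hφ : Measurable φ) : IsTransition fun w => ℓ (φ w) where
  measurable a := (hℓ.measurable a).comp hφ
  nonneg _ := hℓ.nonneg _
  sum_eq_one _ := hℓ.sum_eq_one _

theorem IsTransition.le_one {ℓ : 𝒱 → α → ℝ} (hℓ : IsTransition ℓ) (v : 𝒱) (a : α) : ℓ v a ≤ 1 :=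
  (Finset.single_le_sum (fun b _ => hℓ.nonneg v b) (Finset.mem_univ a)).trans_eq (hℓ.sum_eq_one v)

theorem IsTransition.negMulLog_nonneg {ℓ : 𝒱 → α → ℝ} (hℓ : IsTransition ℓ) (v : 𝒱) (a : α) :
    0 ≤ Real.negMulLog (ℓ v a) :=
  Real.negMulLog_nonneg (hℓ.nonneg v a) (hℓ.le_one v a)

theorem IsTransition.measurable_uncurry [MeasurableSpace α] [MeasurableSingletonClass α]
    {ℓ : 𝒱 → α → ℝ} (hℓ : IsTransition ℓ) : Measurable fun q : 𝒱 × α => ℓ q.1 q.2 :=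
  measurable_from_prod_countable_left hℓ.measurable

end Transition

section ChainTransition

variable {𝒱 α : Type*} {n : ℕ}

/-- The law of a string of length `n` whose letters are drawn one after another, the `k`-th letter
from `ℓ k (v, s)` given the parameter `v` and the string `s` of the earlier letters. -/
def chainTransition (ℓ : (k : Fin n) → 𝒱 × (Fin k → α) → α → ℝ) (v : 𝒱) (h : Fin n → α) : ℝ :=
  ∏ k, ℓ k (v, Fin.take k k.isLt.le h) (h k)

theorem chainTransition_succ (ℓ : (k : Fin (n + 1)) → 𝒱 × (Fin k → α) → α → ℝ) (v : 𝒱)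
    (h : Fin (n + 1) → α) :
    chainTransition ℓ v h = chainTransition (fun k : Fin n => ℓ k.castSucc) v (Fin.init h) *
      ℓ (Fin.last n) (v, Fin.init h) (h (Fin.last n)) :=
  Fin.prod_univ_castSucc _

theorem sum_fin_succ_arrow [Fintype α] {β : Type*} [AddCommMonoid β] (f : (Fin (n + 1) → α) → β) :
    ∑ h, f h = ∑ h : Fin n → α, ∑ a, f (Fin.snoc h a) := by
  rw [← (Fin.snocEquiv fun _ : Fin (n + 1) => α).sum_comp, Fintype.sum_prod_type, Finset.sum_comm]
  rfl

theorem sum_chainTransition [Fintype α] (ℓ : (k : Fin n) → 𝒱 × (Fin k → α) → α → ℝ)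
    (hsum : ∀ k q, ∑ a, ℓ k q a = 1) (v : 𝒱) : ∑ h, chainTransition ℓ v h = 1 := by
  induction n with
  | zero => simp [chainTransition]
  | succ n ih =>
    simp only [sum_fin_succ_arrow, chainTransition_succ, Fin.init_snoc, Fin.snoc_last,
      ← Finset.mul_sum, hsum, mul_one]
    exact ih _ fun k => hsum k.castSucc

theorem sum_negMulLog_chainTransition [Fintype α] (ℓ : (k : Fin n) → 𝒱 × (Fin k → α) → α → ℝ)
    (hsum : ∀ k q, ∑ a, ℓ k q a = 1) {η : Fin n → ℝ}
    (hent : ∀ k q, ∑ a, Real.negMulLog (ℓ k q a) = η k) (v : 𝒱) :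
    ∑ h, Real.negMulLog (chainTransition ℓ v h) = ∑ k, η k := by
  induction n with
  | zero => simp [chainTransition]
  | succ n ih =>
    have hinit := sum_chainTransition (fun k : Fin n => ℓ k.castSucc) (fun k => hsum k.castSucc) v
    have hent_init := ih (fun k => ℓ k.castSucc) (fun k => hsum k.castSucc)
      fun k => hent k.castSucc
    simp only [sum_fin_succ_arrow, chainTransition_succ, Fin.init_snoc, Fin.snoc_last,
      Real.negMulLog_mul, Finset.sum_add_distrib, ← Finset.sum_mul, ← Finset.mul_sum, hsum, hent,
      hinit, hent_init, one_mul, Fin.sum_univ_castSucc]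

theorem IsTransition.chainTransition [MeasurableSpace 𝒱] [Fintype α] [MeasurableSpace α]
    {ℓ : (k : Fin n) → 𝒱 × (Fin k → α) → α → ℝ} (hℓ : ∀ k, IsTransition (ℓ k)) :
    IsTransition (chainTransition ℓ) where
  measurable h := Finset.measurable_prod _ fun k _ =>
    ((hℓ k).measurable (h k)).comp measurable_prodMk_right
  nonneg _ _ := Finset.prod_nonneg fun k _ => (hℓ k).nonneg _ _
  sum_eq_one := sum_chainTransition ℓ fun k => (hℓ k).sum_eq_one

end ChainTransition

section CondLaw

theorem lintegral_condLExp_mul {Ω : Type*} {m m₀ : MeasurableSpace Ω} (hm : m ≤ m₀)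
    {P : Measure Ω} [SigmaFinite (P.trim hm)] {f w : Ω → ℝ≥0∞} (hf : Measurable f)
    (hw : Measurable[m] w) :
    ∫⁻ ω, P⁻[f|m] ω * w ω ∂P = ∫⁻ ω, f ω * w ω ∂P := by
  have htrim : (P.withDensity P⁻[f|m]).trim hm = (P.withDensity f).trim hm := by
    refine @Measure.ext _ m _ _ fun s hs => ?_
    rw [trim_measurableSet_eq hm hs, trim_measurableSet_eq hm hs, withDensity_apply _ (hm s hs),
      withDensity_apply _ (hm s hs), setLIntegral_condLExp hm P f hs]
  have hlintegral {g : Ω → ℝ≥0∞} (hg : Measurable g) :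
      ∫⁻ ω, g ω * w ω ∂P = ∫⁻ ω, w ω ∂(P.withDensity g).trim hm := by
    rw [lintegral_trim hm hw, lintegral_withDensity_eq_lintegral_mul _ hg (hw.mono hm le_rfl)]
    rfl
  rw [hlintegral ((measurable_condLExp m P f).mono hm le_rfl), hlintegral hf, htrim]

variable {Ω 𝒱 𝒲 α : Type*} [MeasurableSpace Ω] [MeasurableSpace 𝒱] [MeasurableSpace 𝒲]
  [Fintype α] [MeasurableSpace α] {P : Measure Ω}

/-- The finite-valued random variable `ρ` has conditional law `ℓ (V ω)` given `V`. -/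
def HasCondLaw (P : Measure Ω) (V : Ω → 𝒱) (ρ : Ω → α) (ℓ : 𝒱 → α → ℝ) : Prop :=
  ∀ w : 𝒱 × α → ℝ≥0∞, Measurable w →
    ∫⁻ ω, w (V ω, ρ ω) ∂P = ∫⁻ ω, ∑ a, ENNReal.ofReal (ℓ (V ω) a) * w (V ω, a) ∂P

theorem hasCondLaw_of_condExp [MeasurableSingletonClass α] [IsFiniteMeasure P] {V : Ω → 𝒱}
    {ρ : Ω → α} {ℓ : 𝒱 → α → ℝ} (hV : Measurable V) (hρ : Measurable ρ) (hℓ : IsTransition ℓ)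
    (h : ∀ a, P⟦{ω | ρ ω = a} | MeasurableSpace.comap V inferInstance⟧ =ᵐ[P] fun ω => ℓ (V ω) a) :
    HasCondLaw P V ρ ℓ := by
  classical
  intro w hw
  let E (a : α) : Ω → ℝ := {ω | ρ ω = a}.indicator fun _ => 1
  have hEm (a : α) : Measurable (E a) :=
    measurable_const.indicator (hρ (measurableSet_singleton a))
  have hE_nonneg (a : α) : 0 ≤ E a := Set.indicator_nonneg fun _ _ => zero_le_one
  have hE_int (a : α) : Integrable (E a) P :=
    (integrable_const 1).indicator (hρ (measurableSet_singleton a))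
  have hwm (a : α) : Measurable[MeasurableSpace.comap V inferInstance] fun ω => w (V ω, a) :=
    (hw.comp measurable_prodMk_right).comp (comap_measurable V)
  have hsplit (ω : Ω) : w (V ω, ρ ω) = ∑ a, ENNReal.ofReal (E a ω) * w (V ω, a) := by
    simp [E, Set.indicator_apply, apply_ite ENNReal.ofReal]
  have hcond (a : α) : P⁻[fun ω => ENNReal.ofReal (E a ω)|MeasurableSpace.comap V inferInstance]
      =ᵐ[P] fun ω => ENNReal.ofReal (ℓ (V ω) a) := by
    filter_upwards [condLExp_ofReal _ (hE_int a) (ae_of_all _ (hE_nonneg a)), h a] with ω h₁ h₂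
    rw [h₁, h₂]
  calc ∫⁻ ω, w (V ω, ρ ω) ∂P = ∑ a, ∫⁻ ω, ENNReal.ofReal (E a ω) * w (V ω, a) ∂P := by
        simp_rw [hsplit]
        exact lintegral_finsetSum _ fun a _ =>
          (hEm a).ennreal_ofReal.mul ((hwm a).mono hV.comap_le le_rfl)
    _ = ∑ a, ∫⁻ ω, ENNReal.ofReal (ℓ (V ω) a) * w (V ω, a) ∂P := by
        refine Finset.sum_congr rfl fun a _ => ?_
        rw [← lintegral_condLExp_mul hV.comap_le (hEm a).ennreal_ofReal (hwm a)]
        exact lintegral_congr_ae ((hcond a).mul .rfl)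
    _ = ∫⁻ ω, ∑ a, ENNReal.ofReal (ℓ (V ω) a) * w (V ω, a) ∂P :=
        (lintegral_finsetSum _ fun a _ => ((hℓ.measurable a).comp hV).ennreal_ofReal.mul
          ((hwm a).mono hV.comap_le le_rfl)).symm

theorem HasCondLaw.of_comp {V : Ω → 𝒱} {ρ : Ω → α} {φ : 𝒱 → 𝒲} {ℓ : 𝒲 → α → ℝ}
    (h : HasCondLaw P V ρ fun v => ℓ (φ v)) (hφ : Measurable φ) :
    HasCondLaw P (fun ω => φ (V ω)) ρ ℓ :=
  fun w hw => h (fun q => w (φ q.1, q.2)) (by fun_prop)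

theorem hasCondLaw_chainTransition [MeasurableSingletonClass α] {n : ℕ} {V : Ω → 𝒱}
    {Z : Ω → Fin n → α} {ℓ : (k : Fin n) → 𝒱 × (Fin k → α) → α → ℝ}
    (hℓ : ∀ k, IsTransition (ℓ k))
    (h : ∀ k : Fin n, HasCondLaw P (fun ω => (V ω, Fin.take k k.isLt.le (Z ω)))
      (fun ω => Z ω k) (ℓ k)) :
    HasCondLaw P V Z (chainTransition ℓ) := by
  induction n with
  | zero =>
    intro w _
    simp [chainTransition, Subsingleton.elim _ (default : Fin 0 → α)]
  | succ n ih =>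
    intro w hw
    have hsnoc : Measurable fun q : (Fin n → α) × α => (Fin.snoc q.1 q.2 : Fin (n + 1) → α) :=
      .of_discrete
    let w' : (𝒱 × (Fin n → α)) × α → ℝ≥0∞ := fun q => w (q.1.1, Fin.snoc q.1.2 q.2)
    have hw' : Measurable w' := hw.comp (by fun_prop)
    have hinit := ih (Z := fun ω => Fin.init (Z ω)) (fun k => hℓ k.castSucc)
      fun k => h k.castSucc
    calc ∫⁻ ω, w (V ω, Z ω) ∂P
        = ∫⁻ ω, w' ((V ω, Fin.init (Z ω)), Z ω (Fin.last n)) ∂P := by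
          simp only [w', Fin.snoc_init_self]
      _ = ∫⁻ ω, ∑ a, ENNReal.ofReal (ℓ (Fin.last n) (V ω, Fin.init (Z ω)) a) *
            w' ((V ω, Fin.init (Z ω)), a) ∂P := h (Fin.last n) w' hw'
      _ = ∫⁻ ω, ∑ s, ENNReal.ofReal (chainTransition (fun k : Fin n => ℓ k.castSucc) (V ω) s) *
            ∑ a, ENNReal.ofReal (ℓ (Fin.last n) (V ω, s) a) * w' ((V ω, s), a) ∂P :=
          hinit (fun q => ∑ a, ENNReal.ofReal (ℓ (Fin.last n) q a) * w' (q, a)) <|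
            Finset.measurable_sum _ fun a _ => ((hℓ (Fin.last n)).measurable a).ennreal_ofReal.mul
              (hw'.comp measurable_prodMk_right)
      _ = ∫⁻ ω, ∑ s, ENNReal.ofReal (chainTransition ℓ (V ω) s) * w (V ω, s) ∂P := by
          have hnonneg := (IsTransition.chainTransition fun k : Fin n => hℓ k.castSucc).nonneg
          simp only [w', sum_fin_succ_arrow, chainTransition_succ, Fin.init_snoc, Fin.snoc_last,
            Finset.mul_sum, ENNReal.ofReal_mul (hnonneg _ _), mul_assoc]

theorem HasCondLaw.ae_pos [MeasurableSingletonClass α] {V : Ω → 𝒱} {ρ : Ω → α} {ℓ : 𝒱 → α → ℝ}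
    (h : HasCondLaw P V ρ ℓ) (hV : Measurable V) (hρ : Measurable ρ) (hℓ : IsTransition ℓ) :
    ∀ᵐ ω ∂P, 0 < ℓ (V ω) (ρ ω) := by
  let S : Set (𝒱 × α) := {q | ℓ q.1 q.2 ≤ 0}
  have hS : MeasurableSet S := measurableSet_le hℓ.measurable_uncurry measurable_const
  have hzero : ∫⁻ ω, S.indicator (1 : 𝒱 × α → ℝ≥0∞) (V ω, ρ ω) ∂P = 0 := by
    rw [h _ (measurable_one.indicator hS)]
    have hterm (v : 𝒱) (a : α) :
        ENNReal.ofReal (ℓ v a) * S.indicator (1 : 𝒱 × α → ℝ≥0∞) (v, a) = 0 := by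
      by_cases ha : ℓ v a ≤ 0 <;> simp [S, ha, ENNReal.ofReal_of_nonpos]
    simp [hterm]
  have hmeas : Measurable fun ω => S.indicator (1 : 𝒱 × α → ℝ≥0∞) (V ω, ρ ω) :=
    (measurable_one.indicator hS).comp (hV.prodMk hρ)
  filter_upwards [(lintegral_eq_zero_iff hmeas).mp hzero] with ω hω
  simpa [S, Set.indicator_apply] using hω

theorem HasCondLaw.lintegral_neg_log [MeasurableSingletonClass α] {V : Ω → 𝒱} {ρ : Ω → α}
    {ℓ : 𝒱 → α → ℝ} (h : HasCondLaw P V ρ ℓ) (hℓ : IsTransition ℓ) :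
    ∫⁻ ω, ENNReal.ofReal (-Real.log (ℓ (V ω) (ρ ω))) ∂P =
      ∫⁻ ω, ENNReal.ofReal (∑ a, Real.negMulLog (ℓ (V ω) a)) ∂P := by
  rw [h (fun q => ENNReal.ofReal (-Real.log (ℓ q.1 q.2)))
    hℓ.measurable_uncurry.log.neg.ennreal_ofReal]
  refine lintegral_congr fun ω => ?_
  rw [ENNReal.ofReal_sum_of_nonneg fun a _ => hℓ.negMulLog_nonneg _ a]
  refine Finset.sum_congr rfl fun a _ => ?_
  rw [← ENNReal.ofReal_mul (hℓ.nonneg _ a), Real.negMulLog, neg_mul_comm]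

section LogLikelihood

variable [MeasurableSingletonClass α] [IsProbabilityMeasure P] {V : Ω → 𝒱} {ρ : Ω → α}
  {ℓ : 𝒱 → α → ℝ} {η : ℝ}

theorem HasCondLaw.integrable_log (h : HasCondLaw P V ρ ℓ) (hV : Measurable V)
    (hρ : Measurable ρ) (hℓ : IsTransition ℓ) (hη : ∀ v, ∑ a, Real.negMulLog (ℓ v a) = η) :
    Integrable (fun ω => Real.log (ℓ (V ω) (ρ ω))) P := by
  have hmeas := (hℓ.measurable_uncurry.comp (hV.prodMk hρ)).log.neg.aestronglyMeasurable (μ := P)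
  have hnonneg (ω : Ω) : 0 ≤ -Real.log (ℓ (V ω) (ρ ω)) :=
    neg_nonneg.mpr (Real.log_nonpos (hℓ.nonneg _ _) (hℓ.le_one _ _))
  refine integrable_neg_iff.mp
    ((lintegral_ofReal_ne_top_iff_integrable hmeas (ae_of_all _ hnonneg)).mp ?_)
  simp [h.lintegral_neg_log hℓ, hη]

theorem HasCondLaw.integral_log (h : HasCondLaw P V ρ ℓ) (hV : Measurable V)
    (hρ : Measurable ρ) (hℓ : IsTransition ℓ) (hη : ∀ v, ∑ a, Real.negMulLog (ℓ v a) = η) :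
    ∫ ω, Real.log (ℓ (V ω) (ρ ω)) ∂P = -η := by
  have hmeas := (hℓ.measurable_uncurry.comp (hV.prodMk hρ)).log.neg.aestronglyMeasurable (μ := P)
  have hnonneg (ω : Ω) : 0 ≤ -Real.log (ℓ (V ω) (ρ ω)) :=
    neg_nonneg.mpr (Real.log_nonpos (hℓ.nonneg _ _) (hℓ.le_one _ _))
  have hη_nonneg : 0 ≤ η := by
    obtain ⟨ω⟩ := P.nonempty_of_neZero
    exact hη (V ω) ▸ Finset.sum_nonneg fun a _ => hℓ.negMulLog_nonneg _ a
  rw [← neg_eq_iff_eq_neg, ← integral_neg,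
    integral_eq_lintegral_of_nonneg_ae (ae_of_all _ hnonneg) hmeas, h.lintegral_neg_log hℓ]
  simp [hη, hη_nonneg]

end LogLikelihood

theorem mul_div_le_of_nonneg {a b : ℝ} (hb : 0 ≤ b) : a * (b / a) ≤ b := by
  rcases eq_or_ne a 0 with rfl | ha
  · simpa using hb
  · exact (mul_div_cancel₀ b ha).le

theorem HasCondLaw.lintegral_div_le [MeasurableSingletonClass α] {V : Ω → 𝒱} {ρ : Ω → α}
    {ℓ : 𝒱 → α → ℝ} (h : HasCondLaw P V ρ ℓ) (hV : Measurable V) (hℓ : IsTransition ℓ)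
    {r : 𝒱 × α → ℝ} (hr : Measurable r) (hr_nonneg : 0 ≤ r) :
    ∫⁻ ω, ENNReal.ofReal (r (V ω, ρ ω) / ℓ (V ω) (ρ ω)) ∂P ≤
      ∑ a, ∫⁻ ω, ENNReal.ofReal (r (V ω, a)) ∂P := by
  have hmeas (a : α) : Measurable fun ω => ENNReal.ofReal (r (V ω, a)) :=
    (hr.comp (hV.prodMk measurable_const)).ennreal_ofReal
  rw [h (fun q => ENNReal.ofReal (r q / ℓ q.1 q.2)) (hr.div hℓ.measurable_uncurry).ennreal_ofReal,
    ← lintegral_finsetSum _ fun a _ => hmeas a]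
  refine lintegral_mono fun ω => Finset.sum_le_sum fun a _ => ?_
  rw [← ENNReal.ofReal_mul (hℓ.nonneg _ a)]
  exact ENNReal.ofReal_le_ofReal (mul_div_le_of_nonneg (hr_nonneg _))

end CondLaw

section Density

variable {Ω E 𝒰 α : Type*} [MeasurableSpace Ω] [MeasurableSpace E] [MeasurableSpace 𝒰]
  {P : Measure Ω} {ν : Measure E} {X : Ω → E} {p : E → ℝ}

theorem ae_pos_of_hasLaw_withDensity
    (hX : HasLaw X (ν.withDensity fun x => ENNReal.ofReal (p x)) P) (hp : Measurable p) :
    ∀ᵐ ω ∂P, 0 < p (X ω) := by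
  refine ae_of_ae_map hX.aemeasurable (p := fun x => 0 < p x) ?_
  rw [hX.map_eq, ae_withDensity_iff hp.ennreal_ofReal]
  exact ae_of_all _ fun x hx => ENNReal.ofReal_pos.mp (pos_iff_ne_zero.mpr hx)

theorem integrable_comp_iff_of_hasLaw_withDensity
    (hX : HasLaw X (ν.withDensity fun x => ENNReal.ofReal (p x)) P) (hp : Measurable p)
    (hp_nonneg : ∀ x, 0 ≤ p x) {f : E → ℝ} (hf : Measurable f) :
    Integrable (fun ω => f (X ω)) P ↔ Integrable (fun x => p x * f x) ν := by
  rw [← Function.comp_def f, ← integrable_map_measure hf.aestronglyMeasurable hX.aemeasurable,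
    hX.map_eq, integrable_withDensity_iff_integrable_smul' hp.ennreal_ofReal (by simp)]
  simp only [ENNReal.toReal_ofReal (hp_nonneg _), smul_eq_mul]

theorem integral_comp_of_hasLaw_withDensity
    (hX : HasLaw X (ν.withDensity fun x => ENNReal.ofReal (p x)) P) (hp : Measurable p)
    (hp_nonneg : ∀ x, 0 ≤ p x) {f : E → ℝ} (hf : Measurable f) :
    ∫ ω, f (X ω) ∂P = ∫ x, p x * f x ∂ν := by
  rw [← Function.comp_def f, hX.integral_comp hf.aestronglyMeasurable,
    integral_withDensity_eq_integral_toReal_smul hp.ennreal_ofReal (by simp)]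
  simp only [ENNReal.toReal_ofReal (hp_nonneg _), smul_eq_mul]

theorem lintegral_div_density_le_one [IsProbabilityMeasure P] {U : Ω → 𝒰} (hU : Measurable U)
    (hind : IndepFun U X P) (hX : HasLaw X (ν.withDensity fun x => ENNReal.ofReal (p x)) P)
    (hp : Measurable p) (hp_nonneg : ∀ x, 0 ≤ p x) {q : E × 𝒰 → ℝ} (hq : Measurable q)
    (hq_nonneg : 0 ≤ q) (hmass : ∀ u, ∫⁻ x, ENNReal.ofReal (q (x, u)) ∂ν ≤ 1) :
    ∫⁻ ω, ENNReal.ofReal (q (X ω, U ω) / p (X ω)) ∂P ≤ 1 := by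
  let F : 𝒰 × E → ℝ≥0∞ := fun y => ENNReal.ofReal (q (y.2, y.1) / p y.2)
  have hF : Measurable F :=
    ((hq.comp measurable_swap).div (hp.comp measurable_snd)).ennreal_ofReal
  have := Measure.isProbabilityMeasure_map (μ := P) hX.aemeasurable
  have := Measure.isProbabilityMeasure_map (μ := P) hU.aemeasurable
  have hseed (u : 𝒰) : ∫⁻ x, F (u, x) ∂P.map X ≤ 1 := by
    have hFu : Measurable fun x => F (u, x) := hF.comp measurable_prodMk_left
    rw [hX.map_eq, lintegral_withDensity_eq_lintegral_mul _ hp.ennreal_ofReal hFu]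
    refine (lintegral_mono fun x => ?_).trans (hmass u)
    simp only [F, Pi.mul_apply, ← ENNReal.ofReal_mul (hp_nonneg x)]
    exact ENNReal.ofReal_le_ofReal (mul_div_le_of_nonneg (hq_nonneg _))
  calc ∫⁻ ω, F (U ω, X ω) ∂P
      = ∫⁻ u, ∫⁻ x, F (u, x) ∂P.map X ∂P.map U := by
        rw [← lintegral_map' hF.aemeasurable (hU.aemeasurable.prodMk hX.aemeasurable),
          (indepFun_iff_map_prod_eq_prod_map_map hU.aemeasurable hX.aemeasurable).mp hind,
          lintegral_prod _ hF.aemeasurable]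
    _ ≤ ∫⁻ _, 1 ∂P.map U := lintegral_mono hseed
    _ = 1 := by simp

theorem HasCondLaw.lintegral_div_density_le_card [Fintype α] [MeasurableSpace α]
    [MeasurableSingletonClass α] [IsProbabilityMeasure P] {U : Ω → 𝒰} {ρ : Ω → α}
    {ℓ : E × 𝒰 → α → ℝ} (h : HasCondLaw P (fun ω => (X ω, U ω)) ρ ℓ) (hℓ : IsTransition ℓ)
    (hX_meas : Measurable X) (hU : Measurable U) (hind : IndepFun U X P)
    (hX : HasLaw X (ν.withDensity fun x => ENNReal.ofReal (p x)) P) (hp : Measurable p)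
    (hp_nonneg : ∀ x, 0 ≤ p x) {q : (E × 𝒰) × α → ℝ} (hq : Measurable q) (hq_nonneg : 0 ≤ q)
    (hmass : ∀ u a, ∫⁻ x, ENNReal.ofReal (q ((x, u), a)) ∂ν ≤ 1) :
    ∫⁻ ω, ENNReal.ofReal (q ((X ω, U ω), ρ ω) / (p (X ω) * ℓ (X ω, U ω) (ρ ω))) ∂P ≤
      Fintype.card α := by
  let r : (E × 𝒰) × α → ℝ := fun y => q y / p y.1.1
  have hr : Measurable r := hq.div (by fun_prop)
  calc ∫⁻ ω, ENNReal.ofReal (q ((X ω, U ω), ρ ω) / (p (X ω) * ℓ (X ω, U ω) (ρ ω))) ∂P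
      = ∫⁻ ω, ENNReal.ofReal (r ((X ω, U ω), ρ ω) / ℓ (X ω, U ω) (ρ ω)) ∂P := by
        simp only [r, div_div]
    _ ≤ ∑ a, ∫⁻ ω, ENNReal.ofReal (r ((X ω, U ω), a)) ∂P :=
        h.lintegral_div_le (hX_meas.prodMk hU) hℓ hr fun y =>
          div_nonneg (hq_nonneg y) (hp_nonneg _)
    _ ≤ ∑ _a : α, 1 := Finset.sum_le_sum fun a _ =>
        lintegral_div_density_le_one hU hind hX hp hp_nonneg
          (hq.comp measurable_prodMk_right) (fun _ => hq_nonneg _) fun u => hmass u a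
    _ = Fintype.card α := by simp

end Density

section Gaussian

variable {V : Type*} [NormedAddCommGroup V] [InnerProductSpace ℝ V]

/-- The density of the centred isotropic Gaussian law on `V` whose variance in each direction
is `s`. -/
noncomputable def gaussianDensity (s : ℝ) (v : V) : ℝ :=
  Real.exp (-‖v‖ ^ 2 / (2 * s)) / (2 * Real.pi * s) ^ (Module.finrank ℝ V / 2 : ℝ)

theorem gaussianDensity_pos {s : ℝ} (hs : 0 < s) (v : V) : 0 < gaussianDensity s v := by
  unfold gaussianDensity
  positivity

theorem log_gaussianDensity {s : ℝ} (hs : 0 < s) (v : V) :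
    Real.log (gaussianDensity s v) =
      -(Module.finrank ℝ V / 2 * Real.log (2 * Real.pi * s) + ‖v‖ ^ 2 / (2 * s)) := by
  have hpos : 0 < 2 * Real.pi * s := by positivity
  rw [gaussianDensity, Real.log_div (Real.exp_pos _).ne' (Real.rpow_pos_of_pos hpos _).ne',
    Real.log_exp, Real.log_rpow hpos]
  ring

variable [MeasurableSpace V] [BorelSpace V]

theorem measurable_gaussianDensity (s : ℝ) : Measurable (gaussianDensity s : V → ℝ) := by
  unfold gaussianDensity
  fun_prop

theorem lintegral_gaussianDensity [FiniteDimensional ℝ V] {s : ℝ} (hs : 0 < s) :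
    ∫⁻ v : V, ENNReal.ofReal (gaussianDensity s v) = 1 := by
  have hone : ∫ v : V, gaussianDensity s v = 1 := by
    have h := GaussianFourier.integral_rexp_neg_mul_sq_norm (V := V) (b := 1 / (2 * s))
      (by positivity)
    have hexponent (v : V) : -‖v‖ ^ 2 / (2 * s) = -(1 / (2 * s)) * ‖v‖ ^ 2 := by ring
    have hbase : Real.pi / (1 / (2 * s)) = 2 * Real.pi * s := by field_simp
    simp only [gaussianDensity, hexponent, integral_div, h, hbase]
    exact div_self (by positivity)
  rw [← ofReal_integral_eq_lintegral_ofReal (integrable_of_integral_eq_one hone)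
    (ae_of_all _ fun v => (gaussianDensity_pos hs v).le), hone, ENNReal.ofReal_one]

end Gaussian

section Gibbs

variable {Ω : Type*} [MeasurableSpace Ω] {P : Measure Ω} [IsProbabilityMeasure P]

theorem integral_log_le_log_of_lintegral_le {Z : Ω → ℝ} (hZ : ∀ᵐ ω ∂P, 0 < Z ω)
    (hlog : Integrable (fun ω => Real.log (Z ω)) P) {c : ℝ} (hc : 0 < c)
    (hle : ∫⁻ ω, ENNReal.ofReal (Z ω) ∂P ≤ ENNReal.ofReal c) :
    ∫ ω, Real.log (Z ω) ∂P ≤ Real.log c := by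
  have hexp : (fun ω => Real.exp (Real.log (Z ω))) =ᵐ[P] Z := by
    filter_upwards [hZ] with ω hω using Real.exp_log hω
  have hmeas : AEStronglyMeasurable Z P :=
    (Real.continuous_exp.comp_aestronglyMeasurable hlog.aestronglyMeasurable).congr hexp
  have hnonneg : 0 ≤ᵐ[P] Z := hZ.mono fun _ => le_of_lt
  have hint : Integrable Z P := (lintegral_ofReal_ne_top_iff_integrable hmeas hnonneg).mp
    (ne_top_of_le_ne_top ENNReal.ofReal_ne_top hle)
  rw [Real.le_log_iff_exp_le hc]
  calc Real.exp (∫ ω, Real.log (Z ω) ∂P) ≤ ∫ ω, Real.exp (Real.log (Z ω)) ∂P :=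
        convexOn_exp.map_integral_le Real.continuous_exp.continuousOn isClosed_univ
          (ae_of_all _ fun _ => Set.mem_univ _) hlog (hint.congr hexp.symm)
    _ = ∫ ω, Z ω ∂P := integral_congr_ae hexp
    _ ≤ c := by
        rw [integral_eq_lintegral_of_nonneg_ae hnonneg hmeas]
        exact ENNReal.toReal_le_of_le_ofReal hc.le hle

variable {V : Type*} [NormedAddCommGroup V] [InnerProductSpace ℝ V]
  {R : Ω → V} {W : Ω → ℝ} {c : ℝ}

theorem integral_log_sub_log_le_of_gaussian (hW : ∀ᵐ ω ∂P, 0 < W ω)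
    (hlog : Integrable (fun ω => Real.log (W ω)) P) (hR : Integrable (fun ω => ‖R ω‖ ^ 2) P)
    (hc : 0 < c) {s : ℝ} (hs : 0 < s)
    (hmass : ∫⁻ ω, ENNReal.ofReal (gaussianDensity s (R ω) * W ω) ∂P ≤ ENNReal.ofReal c) :
    ∫ ω, Real.log (W ω) ∂P - Real.log c ≤
      Module.finrank ℝ V / 2 * Real.log (2 * Real.pi * s) + (∫ ω, ‖R ω‖ ^ 2 ∂P) / (2 * s) := by
  set κ : ℝ := Module.finrank ℝ V / 2 * Real.log (2 * Real.pi * s)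
  have hκ : Integrable (fun ω => κ + ‖R ω‖ ^ 2 / (2 * s)) P :=
    (integrable_const κ).add (hR.div_const _)
  have hlog_mul : (fun ω => Real.log (gaussianDensity s (R ω) * W ω)) =ᵐ[P]
      fun ω => Real.log (W ω) - (κ + ‖R ω‖ ^ 2 / (2 * s)) := by
    filter_upwards [hW] with ω hω
    rw [Real.log_mul (gaussianDensity_pos hs _).ne' hω.ne', log_gaussianDensity hs,
      neg_add_eq_sub]
  have hpos : ∀ᵐ ω ∂P, 0 < gaussianDensity s (R ω) * W ω :=
    hW.mono fun ω hω => mul_pos (gaussianDensity_pos hs _) hω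
  have hgibbs := integral_log_le_log_of_lintegral_le hpos ((hlog.sub hκ).congr hlog_mul.symm) hc
    hmass
  rw [integral_congr_ae hlog_mul, integral_sub hlog hκ,
    integral_add (integrable_const κ) (hR.div_const _), integral_const, integral_div] at hgibbs
  simp only [probReal_univ, one_smul] at hgibbs
  linarith

theorem finrank_mul_exp_le_lintegral_sq_norm [FiniteDimensional ℝ V] [Nontrivial V]
    [MeasurableSpace V] [BorelSpace V] (hR : AEMeasurable R P) (hW : ∀ᵐ ω ∂P, 0 < W ω)
    (hlog : Integrable (fun ω => Real.log (W ω)) P) (hc : 0 < c)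
    (hmass : ∀ s, 0 < s →
      ∫⁻ ω, ENNReal.ofReal (gaussianDensity s (R ω) * W ω) ∂P ≤ ENNReal.ofReal c) :
    ENNReal.ofReal (Module.finrank ℝ V / (2 * Real.pi * Real.exp 1) *
        Real.exp (2 * (∫ ω, Real.log (W ω) ∂P - Real.log c) / Module.finrank ℝ V)) ≤
      ∫⁻ ω, ENNReal.ofReal (‖R ω‖ ^ 2) ∂P := by
  by_cases hfin : ∫⁻ ω, ENNReal.ofReal (‖R ω‖ ^ 2) ∂P = ∞
  · exact hfin ▸ le_top
  set A : ℝ := ∫ ω, Real.log (W ω) ∂P - Real.log c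
  set d : ℝ := (Module.finrank ℝ V : ℝ)
  have hd : 0 < d := Nat.cast_pos.mpr Module.finrank_pos
  -- The bound of `integral_log_sub_log_le_of_gaussian` is best when `s` is the mean square over
  -- `d`; this `s` is the value of that quotient in the case of equality.
  set s : ℝ := Real.exp (2 * A / d) / (2 * Real.pi * Real.exp 1) with hs_def
  have hs : 0 < s := by positivity
  have hnonneg : ∀ᵐ ω ∂P, 0 ≤ ‖R ω‖ ^ 2 := ae_of_all _ fun ω => sq_nonneg _
  have hmeas := (hR.norm.pow_const 2).aestronglyMeasurable
  have hint := (lintegral_ofReal_ne_top_iff_integrable hmeas hnonneg).mp hfin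
  have hgibbs := integral_log_sub_log_le_of_gaussian hW hlog hint hc hs (hmass s hs)
  have hlog_s : d / 2 * Real.log (2 * Real.pi * s) = A - d / 2 := by
    have : 2 * Real.pi * s = Real.exp (2 * A / d - 1) := by
      rw [Real.exp_sub, hs_def]
      field_simp
    rw [this, Real.log_exp]
    field_simp
  have hle : d / (2 * Real.pi * Real.exp 1) * Real.exp (2 * A / d) ≤ ∫ ω, ‖R ω‖ ^ 2 ∂P := by
    have : d / 2 ≤ (∫ ω, ‖R ω‖ ^ 2 ∂P) / (2 * s) := by linarith
    rw [le_div_iff₀ (by positivity)] at this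
    calc d / (2 * Real.pi * Real.exp 1) * Real.exp (2 * A / d) = d / 2 * (2 * s) := by ring
      _ ≤ _ := this
  rw [← ofReal_integral_eq_lintegral_ofReal hint hnonneg]
  exact ENNReal.ofReal_le_ofReal hle

end Gibbs

section LowerBound

variable {Ω V 𝒰 α : Type*} [MeasurableSpace Ω] [MeasurableSpace 𝒰] [Fintype α]
  [MeasurableSpace α] [MeasurableSingletonClass α] [NormedAddCommGroup V] [InnerProductSpace ℝ V]
  [FiniteDimensional ℝ V] [MeasurableSpace V] [BorelSpace V] {P : Measure Ω}
  [IsProbabilityMeasure P]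

theorem HasCondLaw.finrank_mul_exp_le_lintegral_sq_norm_sub [Nontrivial V] {X : Ω → V}
    {U : Ω → 𝒰} {ρ : Ω → α} {ℓ : V × 𝒰 → α → ℝ} {p : V → ℝ} {η : ℝ}
    (h : HasCondLaw P (fun ω => (X ω, U ω)) ρ ℓ) (hℓ : IsTransition ℓ)
    (hη : ∀ v, ∑ a, Real.negMulLog (ℓ v a) = η) (hX_meas : Measurable X) (hU : Measurable U)
    (hρ : Measurable ρ) (hind : IndepFun U X P)
    (hX : HasLaw X (volume.withDensity fun x => ENNReal.ofReal (p x)) P) (hp : Measurable p)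
    (hp_nonneg : ∀ x, 0 ≤ p x) (hent : Integrable fun x => p x * Real.log (p x))
    {f : α → 𝒰 → V} (hf : ∀ a, Measurable (f a)) :
    ENNReal.ofReal (Module.finrank ℝ V / (2 * Real.pi * Real.exp 1) *
        Real.exp (2 * ((-∫ x, p x * Real.log (p x)) - (Real.log (Fintype.card α) - η)) /
          Module.finrank ℝ V)) ≤
      ∫⁻ ω, ENNReal.ofReal (‖X ω - f (ρ ω) (U ω)‖ ^ 2) ∂P := by
  have hXU : Measurable fun ω => (X ω, U ω) := hX_meas.prodMk hU
  have hf_uncurry : Measurable fun y : (V × 𝒰) × α => f y.2 y.1.2 :=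
    measurable_from_prod_countable_left fun a => (hf a).comp measurable_snd
  have hcard : (0 : ℝ) < Fintype.card α := by
    obtain ⟨ω⟩ := P.nonempty_of_neZero
    have : Nonempty α := ⟨ρ ω⟩
    exact Nat.cast_pos.mpr Fintype.card_pos
  let W : Ω → ℝ := fun ω => (p (X ω) * ℓ (X ω, U ω) (ρ ω))⁻¹
  have hpos := (ae_pos_of_hasLaw_withDensity hX hp).and (h.ae_pos hXU hρ hℓ)
  have hlogp := (integrable_comp_iff_of_hasLaw_withDensity hX hp hp_nonneg hp.log).mpr hent
  have hlogℓ := h.integrable_log hXU hρ hℓ hη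
  have hlogW : (fun ω => Real.log (W ω)) =ᵐ[P]
      fun ω => -(Real.log (p (X ω)) + Real.log (ℓ (X ω, U ω) (ρ ω))) := by
    filter_upwards [hpos] with ω hω
    rw [Real.log_inv, Real.log_mul hω.1.ne' hω.2.ne']
  have hmean : ∫ ω, Real.log (W ω) ∂P = -(∫ x, p x * Real.log (p x)) + η := by
    rw [integral_congr_ae hlogW, integral_neg, integral_add hlogp hlogℓ,
      integral_comp_of_hasLaw_withDensity hX hp hp_nonneg hp.log, h.integral_log hXU hρ hℓ hη]
    ring
  have hmass (s : ℝ) (hs : 0 < s) :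
      ∫⁻ ω, ENNReal.ofReal (gaussianDensity s (X ω - f (ρ ω) (U ω)) * W ω) ∂P ≤
        ENNReal.ofReal (Fintype.card α) := by
    rw [ENNReal.ofReal_natCast]
    refine h.lintegral_div_density_le_card hℓ hX_meas hU hind hX hp hp_nonneg
      (q := fun y => gaussianDensity s (y.1.1 - f y.2 y.1.2))
      ((measurable_gaussianDensity s).comp (.sub (by fun_prop) hf_uncurry))
      (fun y => (gaussianDensity_pos hs _).le) fun u a => ?_
    rw [lintegral_sub_right_eq_self (fun v => ENNReal.ofReal (gaussianDensity s v)) (f a u),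
      lintegral_gaussianDensity hs]
  have hA : (-∫ x, p x * Real.log (p x)) - (Real.log (Fintype.card α) - η) =
      ∫ ω, Real.log (W ω) ∂P - Real.log (Fintype.card α) := by
    rw [hmean]
    ring
  rw [hA]
  exact finrank_mul_exp_le_lintegral_sq_norm
    (hX_meas.sub (hf_uncurry.comp (hXU.prodMk hρ))).aemeasurable
    (hpos.mono fun ω hω => inv_pos.mpr (mul_pos hω.1 hω.2))
    ((hlogp.add hlogℓ).neg.congr hlogW.symm) hcard hmass

end LowerBound

section Game

variable {Ω 𝒰 : Type*} [MeasurableSpace Ω] [MeasurableSpace 𝒰] {d M n : ℕ} {P : Measure Ω}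
  {p₀ : Space d → ℝ} {ε : Fin M → ℝ} {X : Ω → Space d} {U : Ω → 𝒰} {Y : ℕ → Ω → Fin M → Bool}

theorem sum_bsc (ε : ℝ) (z : Bool) : ∑ b, bsc ε z b = 1 := by
  cases z <;> simp [bsc]

theorem bsc_nonneg {ε : ℝ} (hε : ε ∈ Set.Icc (0 : ℝ) 1) (z b : Bool) : 0 ≤ bsc ε z b := by
  unfold bsc
  split_ifs
  exacts [sub_nonneg.mpr hε.2, hε.1]

theorem sum_negMulLog_bsc (ε : ℝ) (z : Bool) :
    ∑ b, Real.negMulLog (bsc ε z b) = Real.binEntropy ε := by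
  cases z <;> simp [bsc, Real.binEntropy_eq_negMulLog_add_negMulLog_one_sub, add_comm]

/-- A joint policy is a sequential policy that ignores the earlier responses of the cycle. -/
def JointPolicy.toSequential (ζ : JointPolicy d M 𝒰) : SequentialPolicy d M 𝒰 where
  query k t h _ u := ζ.query k h u t
  measurableSet_query k t h _ := ζ.measurableSet_query k h t

namespace SequentialPolicy

variable (ζ : SequentialPolicy d M 𝒰) (ε : Fin M → ℝ)

/-- The law of the response of player `t` in cycle `k`, given the target, the seed, the responses
of the previous cycles and those of the earlier players in the same cycle. -/
noncomputable def playerLikelihood (k : ℕ) (t : Fin M)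
    (q : ((Space d × 𝒰) × Record M k) × (Fin t → Bool)) (b : Bool) : ℝ :=
  bsc (ε t) (answer (ζ.query k t q.1.2 q.2 q.1.1.2) q.1.1.1) b

/-- The law of the responses of cycle `k`, given the target, the seed and the responses of the
previous cycles. -/
noncomputable def cycleLikelihood (k : ℕ) : (Space d × 𝒰) × Record M k → (Fin M → Bool) → ℝ :=
  chainTransition fun t : Fin M => ζ.playerLikelihood ε k t

/-- The law of the responses of the first `n` cycles, given the target and the seed. -/
noncomputable def recordLikelihood (n : ℕ) : Space d × 𝒰 → Record M n → ℝ :=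
  chainTransition fun k : Fin n => ζ.cycleLikelihood ε k

variable {ε}

theorem isTransition_playerLikelihood (hε : ∀ m, ε m ∈ Set.Icc (0 : ℝ) 1) (k : ℕ) (t : Fin M) :
    IsTransition (ζ.playerLikelihood ε k t) where
  measurable b := by
    classical
    have hmem (r : Record M k × (Fin t → Bool)) :
        MeasurableSet {y : Space d × 𝒰 | y.1 ∈ ζ.query k t r.1 r.2 y.2} :=
      measurable_swap (ζ.measurableSet_query k t r.1 r.2)
    have hanswer (r : Record M k × (Fin t → Bool)) :
        Measurable fun y : Space d × 𝒰 => answer (ζ.query k t r.1 r.2 y.2) y.1 :=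
      measurable_to_bool (by simpa [answer, Set.preimage] using hmem r)
    have hcurried : Measurable fun y : (Space d × 𝒰) × (Record M k × (Fin t → Bool)) =>
        answer (ζ.query k t y.2.1 y.2.2 y.1.2) y.1.1 :=
      measurable_from_prod_countable_left hanswer
    have hbsc : Measurable fun z : Bool => bsc (ε t) z b := .of_discrete
    exact hbsc.comp (hcurried.comp MeasurableEquiv.prodAssoc.measurable)
  nonneg _ b := bsc_nonneg (hε t) _ b
  sum_eq_one _ := sum_bsc _ _

theorem isTransition_cycleLikelihood (hε : ∀ m, ε m ∈ Set.Icc (0 : ℝ) 1) (k : ℕ) :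
    IsTransition (ζ.cycleLikelihood ε k) :=
  .chainTransition (ζ.isTransition_playerLikelihood hε k)

theorem isTransition_recordLikelihood (hε : ∀ m, ε m ∈ Set.Icc (0 : ℝ) 1) (n : ℕ) :
    IsTransition (ζ.recordLikelihood ε n) :=
  .chainTransition fun k : Fin n => ζ.isTransition_cycleLikelihood hε k

theorem sum_negMulLog_cycleLikelihood (k : ℕ) (q : (Space d × 𝒰) × Record M k) :
    ∑ y, Real.negMulLog (ζ.cycleLikelihood ε k q y) = ∑ m, Real.binEntropy (ε m) :=
  sum_negMulLog_chainTransition _ (fun t _ => sum_bsc (ε t) _)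
    (fun t _ => sum_negMulLog_bsc (ε t) _) q

theorem sum_negMulLog_recordLikelihood (n : ℕ) (v : Space d × 𝒰) :
    ∑ h, Real.negMulLog (ζ.recordLikelihood ε n v h) = n * ∑ m, Real.binEntropy (ε m) :=
  (sum_negMulLog_chainTransition (fun k : Fin n => ζ.cycleLikelihood ε k)
    (fun _ => sum_chainTransition _ fun t _ => sum_bsc (ε t) _)
    (fun k => ζ.sum_negMulLog_cycleLikelihood k) v).trans (by simp)

end SequentialPolicy

namespace IsTargetModel

variable (hmodel : IsTargetModel P p₀ X U Y)

include hmodel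

theorem hasLaw : HasLaw X (volume.withDensity fun x => ENNReal.ofReal (p₀ x)) P :=
  ⟨hmodel.measurable_target.aemeasurable, hmodel.map_target⟩

theorem measurable_record (n : ℕ) : Measurable (record Y n) :=
  measurable_pi_lambda _ fun k : Fin n => hmodel.measurable_response k

end IsTargetModel

theorem hasCondLaw_recordLikelihood {ζ : SequentialPolicy d M 𝒰}
    (hε : ∀ m, ε m ∈ Set.Icc (0 : ℝ) 1)
    (hcycle : ∀ k, HasCondLaw P (fun ω => ((X ω, U ω), record Y k ω)) (Y k)
      (ζ.cycleLikelihood ε k)) (n : ℕ) :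
    HasCondLaw P (fun ω => (X ω, U ω)) (record Y n) (ζ.recordLikelihood ε n) :=
  hasCondLaw_chainTransition (fun k : Fin n => ζ.isTransition_cycleLikelihood hε k)
    fun k => hcycle k

theorem IsJointGame.hasCondLaw_cycle [IsFiniteMeasure P] {ζ : JointPolicy d M 𝒰}
    (hgame : IsJointGame P ε ζ X U Y) (hmodel : IsTargetModel P p₀ X U Y)
    (hε : ∀ m, ε m ∈ Set.Icc (0 : ℝ) 1) (k : ℕ) :
    HasCondLaw P (fun ω => ((X ω, U ω), record Y k ω)) (Y k)
      (ζ.toSequential.cycleLikelihood ε k) := by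
  let φ : Space d × 𝒰 × Record M k → (Space d × 𝒰) × Record M k :=
    MeasurableEquiv.prodAssoc.symm
  have hφ : Measurable φ := MeasurableEquiv.measurable _
  have hpast : Measurable fun ω => (X ω, U ω, record Y k ω) :=
    hmodel.measurable_target.prodMk (hmodel.measurable_seed.prodMk (hmodel.measurable_record k))
  exact (hasCondLaw_of_condExp hpast (hmodel.measurable_response k)
    ((ζ.toSequential.isTransition_cycleLikelihood hε k).comp hφ) (hgame k)).of_comp hφ

theorem IsSequentialGame.hasCondLaw_player [IsFiniteMeasure P] {ζ : SequentialPolicy d M 𝒰}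
    (hgame : IsSequentialGame P ε ζ X U Y) (hmodel : IsTargetModel P p₀ X U Y)
    (hε : ∀ m, ε m ∈ Set.Icc (0 : ℝ) 1) (k : ℕ) (t : Fin M) :
    HasCondLaw P (fun ω => (((X ω, U ω), record Y k ω), partialRecord Y k t ω))
      (fun ω => Y k ω t) (ζ.playerLikelihood ε k t) := by
  let φ : Space d × 𝒰 × Record M k × (Fin t → Bool) →
      ((Space d × 𝒰) × Record M k) × (Fin t → Bool) :=
    fun q => (((q.1, q.2.1), q.2.2.1), q.2.2.2)
  have hφ : Measurable φ := by fun_prop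
  have hY := hmodel.measurable_response k
  have hpartial : Measurable (partialRecord Y k t) :=
    measurable_pi_lambda _ fun _ => (measurable_pi_apply _).comp hY
  have hpast : Measurable fun ω => (X ω, U ω, record Y k ω, partialRecord Y k t ω) :=
    hmodel.measurable_target.prodMk
      (hmodel.measurable_seed.prodMk ((hmodel.measurable_record k).prodMk hpartial))
  exact (hasCondLaw_of_condExp hpast ((measurable_pi_apply t).comp hY)
    ((ζ.isTransition_playerLikelihood hε k t).comp hφ) (hgame k t)).of_comp hφ

theorem IsSequentialGame.hasCondLaw_cycle [IsFiniteMeasure P] {ζ : SequentialPolicy d M 𝒰}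
    (hgame : IsSequentialGame P ε ζ X U Y) (hmodel : IsTargetModel P p₀ X U Y)
    (hε : ∀ m, ε m ∈ Set.Icc (0 : ℝ) 1) (k : ℕ) :
    HasCondLaw P (fun ω => ((X ω, U ω), record Y k ω)) (Y k) (ζ.cycleLikelihood ε k) :=
  hasCondLaw_chainTransition (ζ.isTransition_playerLikelihood hε k)
    (hgame.hasCondLaw_player hmodel hε k)

theorem mseBound_eq (p₀ : Space d → ℝ) (ε : Fin M → ℝ) (n : ℕ) :
    mseBound p₀ ε n = d / (2 * Real.pi * Real.exp 1) *
      Real.exp (2 * (diffEntropy p₀ - (Real.log (Fintype.card (Record M n)) -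
        n * ∑ m, Real.binEntropy (ε m))) / d) := by
  have hcapacity : n * ∑ m, capacity (ε m) =
      Real.log (Fintype.card (Record M n)) - n * ∑ m, Real.binEntropy (ε m) := by
    simp [capacity, mul_sub]
  have hexponent : 2 * (diffEntropy p₀ - n * ∑ m, capacity (ε m)) / d =
      2 * diffEntropy p₀ / d + -(2 * n * ∑ m, capacity (ε m)) / d := by
    ring
  rw [← hcapacity, hexponent, Real.exp_add, mseBound]
  ring

theorem IsTargetModel.mseBound_le_mse [IsProbabilityMeasure P]
    (hmodel : IsTargetModel P p₀ X U Y) (hd : 0 < d) (hε : ∀ m, ε m ∈ Set.Icc (0 : ℝ) 1)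
    (hH : HasFiniteEntropy p₀) {ζ : SequentialPolicy d M 𝒰}
    (hcycle : ∀ k, HasCondLaw P (fun ω => ((X ω, U ω), record Y k ω)) (Y k)
      (ζ.cycleLikelihood ε k)) (Xn : Estimator d M 𝒰 n) :
    ENNReal.ofReal (mseBound p₀ ε n) ≤ mse P X (Xn.estimate U Y) := by
  have := Fin.pos_iff_nonempty.mp hd
  have hbound := (hasCondLaw_recordLikelihood hε hcycle n).finrank_mul_exp_le_lintegral_sq_norm_sub
    (ζ.isTransition_recordLikelihood hε n) (ζ.sum_negMulLog_recordLikelihood n)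
    hmodel.measurable_target hmodel.measurable_seed (hmodel.measurable_record n)
    hmodel.indep_seed hmodel.hasLaw hmodel.measurable_prior hmodel.prior_nonneg hH
    Xn.measurable_toFun
  rwa [finrank_euclideanSpace_fin, ← diffEntropy, ← mseBound_eq] at hbound

end Game

end TwentyQuestions

theorem theorem4_general {Ω 𝒰 : Type*} [MeasurableSpace Ω] [MeasurableSpace 𝒰]
    (P : Measure Ω) [IsProbabilityMeasure P] {d M : ℕ} (hd : 0 < d)
    (p₀ : TwentyQuestions.Space d → ℝ) (ε : Fin M → ℝ) (hε : ∀ m, ε m ∈ Set.Icc (0 : ℝ) 1)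
    (X : Ω → TwentyQuestions.Space d) (U : Ω → 𝒰) (Y : ℕ → Ω → Fin M → Bool)
    (hmodel : TwentyQuestions.IsTargetModel P p₀ X U Y)
    (hH : TwentyQuestions.HasFiniteEntropy p₀) (n : ℕ) :
    (∀ ζ : TwentyQuestions.JointPolicy d M 𝒰, TwentyQuestions.IsJointGame P ε ζ X U Y →
      ∀ Xn : TwentyQuestions.Estimator d M 𝒰 n,
        ENNReal.ofReal (TwentyQuestions.mseBound p₀ ε n) ≤
          TwentyQuestions.mse P X (Xn.estimate U Y)) ∧
    (∀ ζ : TwentyQuestions.SequentialPolicy d M 𝒰, TwentyQuestions.IsSequentialGame P ε ζ X U Y →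
      ∀ Xn : TwentyQuestions.Estimator d M 𝒰 n,
        ENNReal.ofReal (TwentyQuestions.mseBound p₀ ε n) ≤
          TwentyQuestions.mse P X (Xn.estimate U Y)) :=
  ⟨fun _ hζ => hmodel.mseBound_le_mse hd hε hH (hζ.hasCondLaw_cycle hmodel hε),
    fun _ hζ => hmodel.mseBound_le_mse hd hε hH (hζ.hasCondLaw_cycle hmodel hε)⟩

theorem theorem4 {Ω 𝒰 : Type*} [MeasurableSpace Ω] [MeasurableSpace 𝒰]
    (P : Measure Ω) [IsProbabilityMeasure P] {d M : ℕ} (hd : 0 < d)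
    (p₀ : TwentyQuestions.Space d → ℝ) (ε : Fin M → ℝ) (hε : ∀ m, ε m ∈ Set.Ioo (0 : ℝ) (1 / 2))
    (X : Ω → TwentyQuestions.Space d) (U : Ω → 𝒰) (Y : ℕ → Ω → Fin M → Bool)
    (hmodel : TwentyQuestions.IsTargetModel P p₀ X U Y)
    (hH : TwentyQuestions.HasFiniteEntropy p₀) (n : ℕ) :
    -- joint policies: the posterior median, and every other estimator
    (∀ ζ : TwentyQuestions.JointPolicy d M 𝒰, TwentyQuestions.IsJointGame P ε ζ X U Y →
      (∀ Xn : TwentyQuestions.Estimator d M 𝒰 n,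
        (∀ᵐ ω ∂P, TwentyQuestions.IsMedian
          (TwentyQuestions.posterior p₀ ε (ζ.asked U Y ω) (fun k => Y k ω) n)
          (Xn.estimate U Y ω)) →
        ENNReal.ofReal (TwentyQuestions.mseBound p₀ ε n) ≤
          TwentyQuestions.mse P X (Xn.estimate U Y)) ∧
      (∀ Xn : TwentyQuestions.Estimator d M 𝒰 n,
        ENNReal.ofReal (TwentyQuestions.mseBound p₀ ε n) ≤
          TwentyQuestions.mse P X (Xn.estimate U Y))) ∧
    -- sequential policies: the posterior median, and every other estimator
    (∀ ζ : TwentyQuestions.SequentialPolicy d M 𝒰, TwentyQuestions.IsSequentialGame P ε ζ X U Y →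
      (∀ Xn : TwentyQuestions.Estimator d M 𝒰 n,
        (∀ᵐ ω ∂P, TwentyQuestions.IsMedian
          (TwentyQuestions.posterior p₀ ε (ζ.asked U Y ω) (fun k => Y k ω) n)
          (Xn.estimate U Y ω)) →
        ENNReal.ofReal (TwentyQuestions.mseBound p₀ ε n) ≤
          TwentyQuestions.mse P X (Xn.estimate U Y)) ∧
      (∀ Xn : TwentyQuestions.Estimator d M 𝒰 n,
        ENNReal.ofReal (TwentyQuestions.mseBound p₀ ε n) ≤
          TwentyQuestions.mse P X (Xn.estimate U Y))) := by
  have hε' (m : Fin M) : ε m ∈ Set.Icc (0 : ℝ) 1 :=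
    ⟨(hε m).1.le, (hε m).2.le.trans one_half_lt_one.le⟩
  have h := theorem4_general P hd p₀ ε hε' X U Y hmodel hH n
  exact ⟨fun ζ hζ => ⟨fun Xn _ => h.1 ζ hζ Xn, h.1 ζ hζ⟩,
    fun ζ hζ => ⟨fun Xn _ => h.2 ζ hζ Xn, h.2 ζ hζ⟩⟩
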